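/- Let $n$ be a natural number, let $0<\zeta_1<\dots<\zeta_n$ be constants, and let $b_1,\dots,b_n:\mathbb R\to\mathbb R$ satisfy $\dot b_j=\zeta_j b_j$ and $b_j(0)>0$ (so $b_j(t)=b_j(0)e^{\zeta_j t}$). For every integer $k$ put $$\tau_k=\sum_{J} b_J\frac{\Delta_J^2}{\Gamma_J},\qquad \sigma_k=\sum_{J}\zeta_J b_J\frac{\Delta_J^2}{\Gamma_J},$$ where the sums run over the $k$-element subsets $J$ of $\{1,\dots,n\}$ and $$b_J=\prod_{j\in J}b_j,\qquad \zeta_J=\prod_{j\in J}\zeta_j,\qquad \Delta_J=\prod_{i<j,\ i,j\in J}(\zeta_j-\zeta_i),\qquad \Gamma_J=\prod_{i<j,\ i,j\in J}(\zeta_j+\zeta_i);$$ thus $\tau_0=\sigma_0=1$ and $\tau_k=\sigma_k=0$ for $k<0$ or $k>n$. Then $\tau_k(t)\neq 0$ for $0\le k\le n$ and all $t\in\mathbb R$, and the functions $$r_k=\frac{\tau_k}{\tau_{k-1}},\qquad s_k=\frac{\sigma_{k-1}}{\tau_k}$$ solve, for all $t\in\mathbb R$, the finite modified B-Toda lattice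 $$\dot r_k=\frac{r_k(\dot s_{k-1}+\dot s_k)}{s_{k-1}-s_k},\qquad \dot s_k=\frac{r_{k+1}}{r_k}\,(s_{k-1}-s_{k+1}),\qquad k=1,\dots,n,$$ with the boundary conditions $s_0=r_{n+1}=0$ and $r_{n+1}s_{n+1}\neq0$. Here $s_{n+1}$ is formally infinite and occurs only through the finite product $r_{n+1}s_{n+1}:=\sigma_n/\tau_n\neq 0$, so that the second equation for $k=n$ means $\dot s_n=(r_{n+1}s_{n-1}-r_{n+1}s_{n+1})/r_n=-(\sigma_n/\tau_n)/r_n$. In particular $r_1,\dots,r_n,s_1,\dots,s_n$ are differentiable and the denominators $r_k$ and $s_{k-1}-s_k$ ($1\le k\le n$) never vanish. -/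

import Mathlib

namespace ModifiedBToda

/-- `Δ_J = ∏_{i < j, i, j ∈ J} (ζ_j - ζ_i)`. -/
def Delta {n : ℕ} (ζ : Fin n → ℝ) (J : Finset (Fin n)) : ℝ :=
  ∏ p ∈ (J ×ˢ J).filter (fun p => p.1 < p.2), (ζ p.2 - ζ p.1)

/-- `Γ_J = ∏_{i < j, i, j ∈ J} (ζ_j + ζ_i)`. -/
def Gamma {n : ℕ} (ζ : Fin n → ℝ) (J : Finset (Fin n)) : ℝ :=
  ∏ p ∈ (J ×ˢ J).filter (fun p => p.1 < p.2), (ζ p.2 + ζ p.1)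

/-- `τ_k = ∑_J b_J Δ_J² / Γ_J`, the sum over the `k`-element subsets `J` of the index set.
The index `k` is any integer; the sum is empty for `k < 0` and for `k > n`. -/
noncomputable def tau {n : ℕ} (ζ b : Fin n → ℝ) (k : ℤ) : ℝ :=
  ∑ J ∈ Finset.univ.filter (fun J : Finset (Fin n) => (J.card : ℤ) = k),
    (∏ j ∈ J, b j) * Delta ζ J ^ 2 / Gamma ζ J

/-- `σ_k = ∑_J ζ_J b_J Δ_J² / Γ_J`, the sum over the `k`-element subsets `J` of the index set. -/
noncomputable def sigma {n : ℕ} (ζ b : Fin n → ℝ) (k : ℤ) : ℝ :=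
  ∑ J ∈ Finset.univ.filter (fun J : Finset (Fin n) => (J.card : ℤ) = k),
    (∏ j ∈ J, ζ j) * (∏ j ∈ J, b j) * Delta ζ J ^ 2 / Gamma ζ J

/-- The finite modified B-Toda lattice for `r_1, …, r_n, s_1, …, s_n`, at all real times,

`r_k' = r_k (s_{k-1}' + s_k') / (s_{k-1} - s_k)`,  `s_k' = (r_{k+1} / r_k) (s_{k-1} - s_{k+1})`,

with `s_0 = r_{n+1} = 0` and `r_{n+1} s_{n+1} ≠ 0`.  Here `s_{n+1}` is formally infinite: it enters
the equations, at `k = n` only, through the finite nonzero product `c = r_{n+1} s_{n+1}`, so that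
the second equation at `k = n` reads `s_n' = (r_{n+1} s_{n-1} - c) / r_n`.  The value `s (n + 1)`
is not used.  That the denominators do not vanish is part of being a solution. -/
structure IsSolution (n : ℕ) (r s : ℤ → ℝ → ℝ) (c : ℝ → ℝ) : Prop where
  s_zero : ∀ t, s 0 t = 0
  r_last : ∀ t, r (n + 1) t = 0
  c_ne_zero : ∀ t, c t ≠ 0
  r_ne_zero : ∀ k : ℤ, 1 ≤ k → k ≤ n → ∀ t, r k t ≠ 0
  s_sub_ne_zero : ∀ k : ℤ, 1 ≤ k → k ≤ n → ∀ t, s (k - 1) t - s k t ≠ 0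
  differentiable_r : ∀ k : ℤ, 1 ≤ k → k ≤ n → Differentiable ℝ (r k)
  differentiable_s : ∀ k : ℤ, 1 ≤ k → k ≤ n → Differentiable ℝ (s k)
  deriv_r : ∀ k : ℤ, 1 ≤ k → k ≤ n → ∀ t,
    deriv (r k) t
      = r k t * (deriv (s (k - 1)) t + deriv (s k) t) / (s (k - 1) t - s k t)
  deriv_s : ∀ k : ℤ, 1 ≤ k → k < n → ∀ t,
    deriv (s k) t = r (k + 1) t / r k t * (s (k - 1) t - s (k + 1) t)
  deriv_s_last : 1 ≤ n → ∀ t,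
    deriv (s n) t = (r (n + 1) t * s (n - 1) t - c t) / r n t

end ModifiedBToda

/-!
The two equations of the lattice, cleared of denominators, are bilinear identities in `τ`, `σ` and
their time derivatives (`bilinear_s`, `bilinear_r`), and the denominators `s_{k-1} - s_k` do not
vanish because `σ_p τ_p - σ_{p-1} τ_{p+1}` is positive (`sigma_mul_tau_sub_pos`). Since
`b_J' = (∑_{j ∈ J} ζ_j) b_J`, all three are statements about double sums over pairs `J, K` of sets
of indices.

These are compared coefficient by coefficient in `b`. Pairs with the same intersection `A` and the
same symmetric difference `B` contribute to the same monomial; they correspond to the splittings of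
`B` into `C = J \ K` and `D = K \ J`, and up to a common factor depending on `A` and `B` only
(`mul_soliton_mul_soliton`) each contributes a weight times `ζ_C Δ_C² Δ_D² Γ_{C,D}`, where
`Γ_{C,D}` is the product of the `ζ_c + ζ_d`. So everything reduces to identities between
polynomials in the variables `ζ_i`, `i ∈ B`, summed over the splittings of `B`.

Such an identity is proved by induction on the cardinality `N` of `B`
(`IsSplitting.splitSum_eq_zero`). Where `ζ_i = ζ_j`, only the splittings that separate `i` from `j`
survive, and the sum is a multiple of the sum for `B \ {i, j}`; so it vanishes there, and to second
order because it is symmetric. As a polynomial in one variable it then has `N - 1` double zeros,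
while its degree is below `2 (N - 1)` except for a few small `N`, which are computed directly. For
`σ_p τ_p - σ_{p-1} τ_{p+1}` the same argument identifies the splitting sum with a sum of positive
terms (`splitSum_weightW`).
-/

namespace ModifiedBToda

open Finset Polynomial

/-! ### Products over pairs of indices -/

section PairProducts

variable {ι : Type*} [LinearOrder ι]

/-- The product of `h i j` over the pairs `i < j` in `J`. It is used for symmetric `h` only, so that
the order of the index type plays no role. -/
def pairProd (h : ι → ι → ℝ) (J : Finset ι) : ℝ :=
  ∏ p ∈ (J ×ˢ J).filter (fun p => p.1 < p.2), h p.1 p.2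

theorem pairProd_eq_prod_ite (h : ι → ι → ℝ) (J : Finset ι) :
    pairProd h J = ∏ i ∈ J, ∏ j ∈ J, if i < j then h i j else 1 := by
  rw [pairProd, prod_filter, prod_product]

@[simp] theorem pairProd_empty (h : ι → ι → ℝ) : pairProd h ∅ = 1 := by simp [pairProd]

theorem pairProd_insert {h : ι → ι → ℝ} (hs : ∀ i j, h i j = h j i) {i : ι} {J : Finset ι}
    (hi : i ∉ J) : pairProd h (insert i J) = pairProd h J * ∏ j ∈ J, h i j := by
  have key : (∏ j ∈ J, if i < j then h i j else 1) * (∏ j ∈ J, if j < i then h j i else 1)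
      = ∏ j ∈ J, h i j := by
    rw [← prod_mul_distrib]
    refine prod_congr rfl fun j hj => ?_
    have hne : i ≠ j := fun e => hi (e ▸ hj)
    rcases lt_or_gt_of_ne hne with hlt | hlt
    · rw [if_pos hlt, if_neg hlt.not_gt, mul_one]
    · rw [if_neg hlt.not_gt, if_pos hlt, one_mul, hs]
  simp only [pairProd_eq_prod_ite, prod_insert hi, lt_irrefl, if_false, one_mul, prod_mul_distrib]
  rw [← key]
  ring

theorem pairProd_union {h : ι → ι → ℝ} (hs : ∀ i j, h i j = h j i) {A C : Finset ι}
    (hd : Disjoint A C) :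
    pairProd h (A ∪ C) = pairProd h A * pairProd h C * ∏ a ∈ A, ∏ c ∈ C, h a c := by
  induction A using Finset.induction_on with
  | empty => simp
  | insert i A hi ih =>
    rw [disjoint_insert_left] at hd
    rw [insert_union, pairProd_insert hs (by simp [hi, hd.1]), ih hd.2, pairProd_insert hs hi,
      prod_insert hi, prod_union hd.2]
    ring

theorem pairProd_congr {h h' : ι → ι → ℝ} {J : Finset ι}
    (hh : ∀ i ∈ J, ∀ j ∈ J, h i j = h' i j) : pairProd h J = pairProd h' J := by
  refine prod_congr rfl fun p hp => ?_
  simp only [mem_filter, mem_product] at hp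
  exact hh _ hp.1.1 _ hp.1.2

theorem pairProd_map {h : ι → ι → ℝ} (hs : ∀ i j, h i j = h j i) (e : Equiv.Perm ι)
    (J : Finset ι) :
    pairProd h (J.map e.toEmbedding) = pairProd (fun i j => h (e i) (e j)) J := by
  induction J using Finset.induction_on with
  | empty => simp
  | insert i J hi ih =>
    rw [map_insert, pairProd_insert hs (by simpa using hi), ih,
      pairProd_insert (fun i j => hs _ _) hi, prod_map]
    rfl

theorem pairProd_eq_zero {h : ι → ι → ℝ} (hs : ∀ i j, h i j = h j i) {J : Finset ι} {i j : ι}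
    (hi : i ∈ J) (hj : j ∈ J) (hij : i ≠ j) (h0 : h i j = 0) : pairProd h J = 0 := by
  rw [← insert_erase hi, pairProd_insert hs (notMem_erase i J),
    prod_eq_zero (mem_erase.2 ⟨hij.symm, hj⟩) h0, mul_zero]

theorem pairProd_pos {h : ι → ι → ℝ} {J : Finset ι}
    (hh : ∀ i ∈ J, ∀ j ∈ J, i < j → 0 < h i j) : 0 < pairProd h J := by
  refine prod_pos fun p hp => ?_
  simp only [mem_filter, mem_product] at hp
  exact hh _ hp.1.1 _ hp.1.2 hp.2

end PairProducts

/-! ### Polynomial functions of bounded degree -/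

section PolynomialFunctions

/-- `f` is a polynomial function of degree at most `d`. -/
def PolyLE (d : ℕ) (f : ℝ → ℝ) : Prop := ∃ p : ℝ[X], p.natDegree ≤ d ∧ ∀ u, f u = p.eval u

theorem PolyLE.mono {d d' : ℕ} {f : ℝ → ℝ} (hf : PolyLE d f) (h : d ≤ d') : PolyLE d' f := by
  obtain ⟨p, hp, he⟩ := hf
  exact ⟨p, hp.trans h, he⟩

theorem polyLE_const (c : ℝ) : PolyLE 0 fun _ => c := ⟨C c, by simp, by simp⟩

theorem polyLE_id : PolyLE 1 fun u => u := ⟨X, by simp, by simp⟩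

theorem PolyLE.add {d : ℕ} {f g : ℝ → ℝ} (hf : PolyLE d f) (hg : PolyLE d g) :
    PolyLE d fun u => f u + g u := by
  obtain ⟨p, hp, he⟩ := hf
  obtain ⟨q, hq, he'⟩ := hg
  exact ⟨p + q, natDegree_add_le_of_degree_le hp hq, by simp [he, he']⟩

theorem PolyLE.mul {d d' : ℕ} {f g : ℝ → ℝ} (hf : PolyLE d f) (hg : PolyLE d' g) :
    PolyLE (d + d') fun u => f u * g u := by
  obtain ⟨p, hp, he⟩ := hf
  obtain ⟨q, hq, he'⟩ := hg
  exact ⟨p * q, natDegree_mul_le_of_le hp hq, by simp [he, he']⟩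

theorem PolyLE.const_mul {d : ℕ} {f : ℝ → ℝ} (c : ℝ) (hf : PolyLE d f) :
    PolyLE d fun u => c * f u := by
  simpa using (polyLE_const c).mul hf

theorem PolyLE.sub {d : ℕ} {f g : ℝ → ℝ} (hf : PolyLE d f) (hg : PolyLE d g) :
    PolyLE d fun u => f u - g u := by
  simpa [sub_eq_add_neg] using hf.add (hg.const_mul (-1))

theorem PolyLE.pow {d : ℕ} {f : ℝ → ℝ} (hf : PolyLE d f) (m : ℕ) :
    PolyLE (m * d) fun u => f u ^ m := by
  obtain ⟨p, hp, he⟩ := hf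
  exact ⟨p ^ m, natDegree_pow_le_of_le m hp, by simp [he]⟩

theorem PolyLE.sum {κ : Type*} {s : Finset κ} {d : ℕ} {f : κ → ℝ → ℝ}
    (hf : ∀ k ∈ s, PolyLE d (f k)) : PolyLE d fun u => ∑ k ∈ s, f k u := by
  classical
  induction s using Finset.induction_on with
  | empty => simpa using (polyLE_const 0).mono (Nat.zero_le d)
  | insert a s ha ih =>
    simp only [sum_insert ha]
    exact (hf a (mem_insert_self a s)).add (ih fun k hk => hf k (mem_insert_of_mem hk))

theorem PolyLE.prod {κ : Type*} {s : Finset κ} {d : ℕ} {f : κ → ℝ → ℝ}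
    (hf : ∀ k ∈ s, PolyLE d (f k)) : PolyLE (s.card * d) fun u => ∏ k ∈ s, f k u := by
  classical
  induction s using Finset.induction_on with
  | empty => simpa using polyLE_const 1
  | insert a s ha ih =>
    simp only [prod_insert ha, card_insert_of_notMem ha]
    exact ((hf a (mem_insert_self a s)).mul
      (ih fun k hk => hf k (mem_insert_of_mem hk))).mono (by ring_nf; rfl)

/-- A polynomial with double zeros at `k` distinct points and of degree below `2 k` vanishes. -/
theorem eq_zero_of_double_roots {κ : Type*} {s : Finset κ} {x : κ → ℝ} (hx : Set.InjOn x s)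
    {p : ℝ[X]} (hp : p.natDegree < 2 * s.card) (h0 : ∀ k ∈ s, p.eval (x k) = 0)
    (h1 : ∀ k ∈ s, p.derivative.eval (x k) = 0) : p = 0 := by
  by_contra hne
  have hdvd : ∏ k ∈ s, (X - C (x k)) ^ 2 ∣ p := by
    refine Finset.prod_dvd_of_coprime (fun a ha b hb hab => ?_) fun k hk => ?_
    · exact (isCoprime_X_sub_C_of_isUnit_sub
        (sub_ne_zero.2 fun e => hab (hx ha hb e)).isUnit).pow
    · exact (le_rootMultiplicity_iff hne).1
        ((one_lt_rootMultiplicity_iff_isRoot hne).2 ⟨h0 k hk, h1 k hk⟩)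
  have hdeg := natDegree_le_of_dvd hdvd hne
  rw [natDegree_prod_of_monic _ _ fun k _ => (monic_X_sub_C (x k)).pow 2] at hdeg
  simp only [natDegree_pow, natDegree_X_sub_C, sum_const, smul_eq_mul, mul_one] at hdeg
  omega

end PolynomialFunctions

/-! ### Symmetric sums over the splittings of a finite set -/

section Splittings

theorem sum_powerset_insert_split {ι M : Type*} [DecidableEq ι] [AddCommMonoid M] {i : ι}
    {B : Finset ι} (hi : i ∉ B) (f : Finset ι → Finset ι → M) :
    ∑ C ∈ (insert i B).powerset, f C (insert i B \ C)
      = ∑ C ∈ B.powerset, (f C (insert i (B \ C)) + f (insert i C) (B \ C)) := by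
  rw [sum_powerset_insert hi, ← sum_add_distrib]
  refine sum_congr rfl fun C hC => ?_
  have hiC : i ∉ C := fun h => hi (mem_powerset.1 hC h)
  rw [insert_sdiff_of_notMem _ hiC, insert_sdiff_insert, sdiff_insert_of_notMem hi]

variable {ι : Type*} [LinearOrder ι]

/-- The factor that splits off from the summands of a splitting sum over `insert i (insert j B)`
when the `i`th and the `j`th variables coincide. -/
def crossFactor (i : ι) (B : Finset ι) (x : ι → ℝ) : ℝ :=
  2 * x i ^ 2 * ∏ a ∈ B, ((x i - x a) ^ 2 * (x i + x a))

/-- The algebraic properties of a function `g C D` of real variables `x`, attached to two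
disjoint finite sets of indices, that make the sum of `g C (B \ C)` over the subsets `C` of `B`
symmetric, and reduce it to `B \ {i, j}` where `x i = x j`. -/
structure IsSplitting (g : Finset ι → Finset ι → (ι → ℝ) → ℝ) : Prop where
  differentiable : ∀ C D, Differentiable ℝ (g C D)
  map : ∀ (e : Equiv.Perm ι) C D x,
    g (C.map e.toEmbedding) (D.map e.toEmbedding) x = g C D fun i => x (e i)
  left : ∀ C D x i j, i ∈ C → j ∈ C → i ≠ j → x i = x j → g C D x = 0
  right : ∀ C D x i j, i ∈ D → j ∈ D → i ≠ j → x i = x j → g C D x = 0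
  cross : ∀ C D x i j, Disjoint C D → i ∉ C ∪ D → j ∉ C ∪ D → i ≠ j → x i = x j →
    g (insert i C) (insert j D) x = crossFactor i (C ∪ D) x * g C D x

/-- The sum of `g C D` over the splittings of `B` into a subset `C` and its complement `D`. -/
def splitSum (g : Finset ι → Finset ι → (ι → ℝ) → ℝ) (B : Finset ι) (x : ι → ℝ) : ℝ :=
  ∑ C ∈ B.powerset, g C (B \ C) x

variable {g : Finset ι → Finset ι → (ι → ℝ) → ℝ}

/-- Splittings with `i` and `j` on the same side do not contribute where `x i = x j`, and each
splitting of `B` arises from two of the others. -/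
theorem IsSplitting.splitSum_insert_insert (hg : IsSplitting g) {B : Finset ι} {x : ι → ℝ}
    {i j : ι} (hi : i ∉ B) (hj : j ∉ B) (hij : i ≠ j) (hx : x i = x j) :
    splitSum g (insert i (insert j B)) x = 2 * crossFactor i B x * splitSum g B x := by
  have hi' : i ∉ insert j B := by simp [hij, hi]
  rw [splitSum, sum_powerset_insert_split hi' fun C D => g C D x, sum_add_distrib,
    sum_powerset_insert_split hj fun C D => g C (insert i D) x,
    sum_powerset_insert_split hj fun C D => g (insert i C) D x, ← sum_add_distrib, splitSum,
    mul_sum]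
  refine sum_congr rfl fun C hC => ?_
  have hCB := mem_powerset.1 hC
  have hu : C ∪ B \ C = B := union_sdiff_of_subset hCB
  rw [hg.right C (insert i (insert j (B \ C))) x i j (by simp) (by simp) hij hx,
    hg.cross C (B \ C) x i j disjoint_sdiff (by rwa [hu]) (by rwa [hu]) hij hx,
    hg.cross C (B \ C) x j i disjoint_sdiff (by rwa [hu]) (by rwa [hu]) hij.symm hx.symm,
    hg.left (insert i (insert j C)) (B \ C) x i j (by simp) (by simp) hij hx, hu, crossFactor,
    crossFactor, hx]
  ring

theorem IsSplitting.differentiable_splitSum [Fintype ι] (hg : IsSplitting g) (B : Finset ι) :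
    Differentiable ℝ (splitSum g B) := by
  have : splitSum g B = fun x => ∑ C ∈ B.powerset, g C (B \ C) x := rfl
  rw [this]
  exact Differentiable.fun_sum fun C _ => hg.differentiable C (B \ C)

theorem IsSplitting.splitSum_perm (hg : IsSplitting g) {B : Finset ι} {e : Equiv.Perm ι}
    (he : B.map e.toEmbedding = B) (x : ι → ℝ) :
    splitSum g B (fun i => x (e i)) = splitSum g B x := by
  have hmem : ∀ C, C ⊆ B → C.map e.toEmbedding ⊆ B := fun C hC => by
    rw [← he]; exact map_subset_map.2 hC
  refine sum_bij (fun C _ => C.map e.toEmbedding)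
    (fun C hC => mem_powerset.2 (hmem C (mem_powerset.1 hC)))
    (fun C _ C' _ h => map_injective _ h) (fun C hC => ?_) fun C _ => ?_
  · refine ⟨C.map e.symm.toEmbedding, ?_, ?_⟩
    · rw [mem_powerset, ← map_subset_map (f := e.toEmbedding), he]
      intro a ha
      simp only [map_map, mem_map] at ha
      obtain ⟨c, hc, rfl⟩ := ha
      simpa using mem_powerset.1 hC hc
    · ext a; simp
  · rw [← hg.map]
    congr 1
    conv_rhs => rw [← he]
    ext a; simp

theorem map_swap_eq {B : Finset ι} {i j : ι} (hi : i ∈ B) (hj : j ∈ B) :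
    B.map (Equiv.swap i j).toEmbedding = B := by
  refine eq_of_subset_of_card_le (fun a ha => ?_) (by simp)
  obtain ⟨b, hb, rfl⟩ := mem_map.1 ha
  simp only [Equiv.coe_toEmbedding]
  by_cases h1 : b = i
  · simpa [h1] using hj
  by_cases h2 : b = j
  · simpa [h2] using hi
  rwa [Equiv.swap_apply_of_ne_of_ne h1 h2]

variable [Fintype ι]

/-- A function that is symmetric in two variables and vanishes where they coincide vanishes there
to second order. -/
theorem fderiv_single_eq_zero_of_swap {F : (ι → ℝ) → ℝ} (hF : Differentiable ℝ F) {i j : ι}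
    (hij : i ≠ j) (hs : ∀ x, F (fun k => x (Equiv.swap i j k)) = F x) {y : ι → ℝ}
    (hy : y i = y j) (h0 : ∀ t : ℝ, F (y + t • (Pi.single i 1 + Pi.single j 1)) = 0) :
    fderiv ℝ F y (Pi.single i 1) = 0 := by
  -- The directional derivatives along the two axes agree by symmetry, and their sum is the
  -- derivative along the hyperplane, on which the function is zero.
  have hline : ∀ v : ι → ℝ, HasDerivAt (fun t : ℝ => F (y + t • v)) (fderiv ℝ F y v) 0 := by
    intro v
    have h1 : HasDerivAt (fun t : ℝ => y + t • v) v 0 := by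
      simpa using ((hasDerivAt_id (0 : ℝ)).smul_const v).const_add y
    have h2 : HasFDerivAt F (fderiv ℝ F y) (y + (0 : ℝ) • v) := by
      simpa using (hF y).hasFDerivAt
    exact h2.comp_hasDerivAt 0 h1
  have hsym : fderiv ℝ F y (Pi.single i 1) = fderiv ℝ F y (Pi.single j 1) := by
    refine (hline _).unique ?_
    refine (hline (Pi.single j 1)).congr_of_eventuallyEq (.of_forall fun t => ?_)
    beta_reduce
    rw [← hs]
    congr 1
    ext k
    by_cases h1 : k = i
    · subst h1; simp [hy, hij, hij.symm]
    by_cases h2 : k = j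
    · subst h2; simp [hy]
    simp [Equiv.swap_apply_of_ne_of_ne h1 h2, h1, h2]
  have hsum : fderiv ℝ F y (Pi.single i 1 + Pi.single j 1) = 0 := by
    refine (hline _).unique ?_
    simp only [h0]
    exact hasDerivAt_const _ _
  rw [map_add, ← hsym] at hsum
  linarith

/-- The vanishing criterion: by induction the splitting sum vanishes where two of the variables
coincide, to second order because it is symmetric; as a polynomial in one variable it then has more
zeros than its degree allows. -/
theorem IsSplitting.splitSum_eq_zero (hg : IsSplitting g) (N₀ : ℕ) (hN₀ : 1 ≤ N₀)
    (hdeg : ∀ (C D : Finset ι) x i, Disjoint C D → i ∈ C ∪ D → N₀ < C.card + D.card →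
      PolyLE (2 * (C.card + D.card) - 3) fun u => g C D (Function.update x i u))
    (hbase : ∀ B : Finset ι, B.card ≤ N₀ → ∀ x, splitSum g B x = 0)
    (B : Finset ι) (x : ι → ℝ) (hx : Set.InjOn x B) : splitSum g B x = 0 := by
  induction hN : B.card using Nat.strong_induction_on generalizing B x with
  | _ N ih =>
    subst hN
    rcases le_or_gt B.card N₀ with hle | hlt
    · exact hbase B hle x
    obtain ⟨i, hi⟩ : B.Nonempty := card_pos.1 (by omega)
    have hzero : ∀ j ∈ B.erase i, ∀ y : ι → ℝ, Set.InjOn y ((B.erase i).erase j) → y i = y j →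
        splitSum g B y = 0 := by
      intro j hj y hy hyij
      have hBeq : B = insert i (insert j ((B.erase i).erase j)) := by
        rw [insert_erase hj, insert_erase hi]
      have hc := card_erase_of_mem hj
      have hc' := card_erase_of_mem hi
      rw [hBeq, hg.splitSum_insert_insert (by simp) (by simp) (ne_of_mem_erase hj).symm hyij,
        ih _ (by omega) _ y hy rfl, mul_zero]
    obtain ⟨p, hp, hpe⟩ : PolyLE (2 * B.card - 3)
        fun u => splitSum g B (Function.update x i u) := by
      refine PolyLE.sum fun C hC => ?_
      have hCB := mem_powerset.1 hC
      have hcard : C.card + (B \ C).card = B.card := by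
        rw [add_comm]; exact card_sdiff_add_card_eq_card hCB
      rw [← hcard]
      exact hdeg C (B \ C) x i disjoint_sdiff (by rwa [union_sdiff_of_subset hCB]) (by omega)
    -- As a function of the `i`th variable the sum is a polynomial `p` with a double zero at each
    -- of the other `x j`.
    suffices p = 0 by
      simpa [this] using hpe (x i)
    refine eq_zero_of_double_roots (s := B.erase i) (x := x)
      (hx.mono (by simp)) ?_ (fun j hj => ?_) fun j hj => ?_
    · rw [card_erase_of_mem hi]; omega
    all_goals
      have hji := ne_of_mem_erase hj
      have hinj : ∀ y : ι → ℝ, (∀ k, k ≠ i → k ≠ j → y k = x k) →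
          Set.InjOn y ((B.erase i).erase j) := by
        intro y hy a ha b hb hab
        simp only [coe_erase, Set.mem_sdiff, mem_coe, Set.mem_singleton_iff] at ha hb
        rw [hy a ha.1.2 ha.2, hy b hb.1.2 hb.2] at hab
        exact hx ha.1.1 hb.1.1 hab
    · rw [← hpe]
      exact hzero j hj _ (hinj _ fun k hk _ => by simp [hk]) (by simp [hji])
    · have hd := fderiv_single_eq_zero_of_swap (hg.differentiable_splitSum B) hji.symm
        (hg.splitSum_perm (map_swap_eq hi (mem_of_mem_erase hj)))
        (y := Function.update x i (x j)) (by simp [hji])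
        (fun t => hzero j hj _ (hinj _ fun k h1 h2 => by simp [h1, h2]) (by simp [hji, hji.symm]))
      have h1 : HasDerivAt (fun u => Function.update x i u) (Pi.single i (1 : ℝ)) (x j) := by
        exact hasDerivAt_update x i (x j)
      have h2 := ((hg.differentiable_splitSum B) _).hasFDerivAt.comp_hasDerivAt (x j) h1
      rw [hd] at h2
      have h3 : (splitSum g B ∘ fun u => Function.update x i u) = fun u => p.eval u := funext hpe
      rw [h3] at h2
      exact (p.hasDerivAt (x j)).unique h2

end Splittings

/-! ### The kernels of the splitting sums -/

section Kernels

variable {ι : Type*} [LinearOrder ι]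

/-- The squared Vandermonde product of the variables with index in `C`. -/
def vandSq (C : Finset ι) (x : ι → ℝ) : ℝ := pairProd (fun i j => (x i - x j) ^ 2) C

/-- The product of `x i + x j` over the pairs of indices in `C`. -/
def plusProd (C : Finset ι) (x : ι → ℝ) : ℝ := pairProd (fun i j => x i + x j) C

@[simp] theorem vandSq_empty (x : ι → ℝ) : vandSq ∅ x = 1 := pairProd_empty _

@[simp] theorem plusProd_empty (x : ι → ℝ) : plusProd ∅ x = 1 := pairProd_empty _

theorem vandSq_insert {i : ι} {C : Finset ι} (hi : i ∉ C) (x : ι → ℝ) :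
    vandSq (insert i C) x = vandSq C x * ∏ c ∈ C, (x i - x c) ^ 2 :=
  pairProd_insert (fun _ _ => by ring) hi

theorem plusProd_insert {i : ι} {C : Finset ι} (hi : i ∉ C) (x : ι → ℝ) :
    plusProd (insert i C) x = plusProd C x * ∏ c ∈ C, (x i + x c) :=
  pairProd_insert (fun _ _ => by ring) hi

@[simp] theorem vandSq_singleton (i : ι) (x : ι → ℝ) : vandSq {i} x = 1 := by
  rw [← insert_empty_eq, vandSq_insert (by simp)]; simp

@[simp] theorem plusProd_singleton (i : ι) (x : ι → ℝ) : plusProd {i} x = 1 := by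
  rw [← insert_empty_eq, plusProd_insert (by simp)]; simp

theorem vandSq_map (e : Equiv.Perm ι) (C : Finset ι) (x : ι → ℝ) :
    vandSq (C.map e.toEmbedding) x = vandSq C fun i => x (e i) :=
  pairProd_map (fun _ _ => by ring) e C

theorem plusProd_map (e : Equiv.Perm ι) (C : Finset ι) (x : ι → ℝ) :
    plusProd (C.map e.toEmbedding) x = plusProd C fun i => x (e i) :=
  pairProd_map (fun _ _ => by ring) e C

theorem vandSq_eq_zero {C : Finset ι} {x : ι → ℝ} {i j : ι} (hi : i ∈ C) (hj : j ∈ C)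
    (hij : i ≠ j) (hx : x i = x j) : vandSq C x = 0 :=
  pairProd_eq_zero (fun _ _ => by ring) hi hj hij (by simp [hx])

theorem vandSq_update {C : Finset ι} {i : ι} (hi : i ∉ C) (x : ι → ℝ) (u : ℝ) :
    vandSq C (Function.update x i u) = vandSq C x := by
  refine pairProd_congr fun a ha b hb => ?_
  have h1 : a ≠ i := fun h => hi (h ▸ ha)
  have h2 : b ≠ i := fun h => hi (h ▸ hb)
  simp [h1, h2]

theorem plusProd_update {C : Finset ι} {i : ι} (hi : i ∉ C) (x : ι → ℝ) (u : ℝ) :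
    plusProd C (Function.update x i u) = plusProd C x := by
  refine pairProd_congr fun a ha b hb => ?_
  have h1 : a ≠ i := fun h => hi (h ▸ ha)
  have h2 : b ≠ i := fun h => hi (h ▸ hb)
  simp [h1, h2]

theorem polyLE_update (x : ι → ℝ) (i j : ι) : PolyLE 1 fun u => Function.update x i u j := by
  by_cases h : j = i
  · subst h; simpa using polyLE_id
  · simpa [h] using (polyLE_const (x j)).mono zero_le_one

theorem polyLE_prod_update {C : Finset ι} {i : ι} (hi : i ∉ C) (x : ι → ℝ) {f : ℝ → ℝ → ℝ}
    {d : ℕ} (hf : ∀ v, PolyLE d fun u => f u v) :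
    PolyLE (C.card * d) fun u => ∏ c ∈ C, f u (Function.update x i u c) := by
  refine PolyLE.prod fun c hc => ?_
  have h : c ≠ i := fun h => hi (h ▸ hc)
  simpa [h] using hf (x c)

theorem polyLE_vandSq {C : Finset ι} {i : ι} (hi : i ∈ C) (x : ι → ℝ) :
    PolyLE (2 * (C.card - 1)) fun u => vandSq C (Function.update x i u) := by
  obtain ⟨C, hC, rfl⟩ : ∃ C', i ∉ C' ∧ insert i C' = C :=
    ⟨C.erase i, notMem_erase i C, insert_erase hi⟩
  simp only [vandSq_insert hC, vandSq_update hC, card_insert_of_notMem hC, Function.update_self]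
  refine (PolyLE.const_mul _ (polyLE_prod_update hC x (f := fun u v => (u - v) ^ 2) (d := 2)
    fun v => ?_)).mono (by simp [mul_comm])
  exact (polyLE_id.sub ((polyLE_const v).mono zero_le_one)).pow 2

theorem polyLE_plusProd {C : Finset ι} {i : ι} (hi : i ∈ C) (x : ι → ℝ) :
    PolyLE (C.card - 1) fun u => plusProd C (Function.update x i u) := by
  obtain ⟨C, hC, rfl⟩ : ∃ C', i ∉ C' ∧ insert i C' = C :=
    ⟨C.erase i, notMem_erase i C, insert_erase hi⟩
  simp only [plusProd_insert hC, plusProd_update hC, card_insert_of_notMem hC,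
    Function.update_self]
  refine (PolyLE.const_mul _ (polyLE_prod_update hC x (f := fun u v => u + v) (d := 1)
    fun v => ?_)).mono (by simp)
  exact polyLE_id.add ((polyLE_const v).mono zero_le_one)

theorem polyLE_prod_self {C : Finset ι} {i : ι} (hi : i ∈ C) (x : ι → ℝ) :
    PolyLE 1 fun u => ∏ c ∈ C, Function.update x i u c := by
  obtain ⟨C, hC, rfl⟩ : ∃ C', i ∉ C' ∧ insert i C' = C :=
    ⟨C.erase i, notMem_erase i C, insert_erase hi⟩
  simp only [prod_insert hC, Function.update_self]
  simpa using polyLE_id.mul (polyLE_prod_update hC x (f := fun u v => v) (d := 0) polyLE_const)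

theorem polyLE_prod_of_notMem {C : Finset ι} {i : ι} (hi : i ∉ C) (x : ι → ℝ) :
    PolyLE 0 fun u => ∏ c ∈ C, Function.update x i u c := by
  simpa using polyLE_prod_update hi x (f := fun u v => v) (d := 0) polyLE_const

/-- The numerator `x_C Δ_C² Δ_D² Γ_{C,D}` of the coefficients in the products of the `σ_p` with
the `τ_q`, over the common denominator `Γ_{C ∪ D}`, where `Γ_{C,D}` is the product of the
`x_c + x_d` over `c ∈ C` and `d ∈ D`. -/
def splitKernel (C D : Finset ι) (x : ι → ℝ) : ℝ :=
  (∏ c ∈ C, x c) * (vandSq C x * vandSq D x * ∏ c ∈ C, ∏ d ∈ D, (x c + x d))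

/-- The positive counterpart `2^m x_C x_D Δ_C² Δ_D² Γ_C Γ_D` of `splitKernel` on the splittings
into two sets of equal cardinality `m`. -/
def posKernel (C D : Finset ι) (x : ι → ℝ) : ℝ :=
  if C.card = D.card then
    2 ^ C.card * ((∏ c ∈ C, x c) * vandSq C x * plusProd C x)
      * ((∏ d ∈ D, x d) * vandSq D x * plusProd D x)
  else 0

/-- A factor by which a splitting kernel may be multiplied: it is symmetric, and unchanged when two
equal variables are added, one on either side. -/
structure IsWeight (w : Finset ι → Finset ι → (ι → ℝ) → ℝ) : Prop where
  differentiable : ∀ C D, Differentiable ℝ (w C D)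
  map : ∀ (e : Equiv.Perm ι) C D x,
    w (C.map e.toEmbedding) (D.map e.toEmbedding) x = w C D fun i => x (e i)
  cross : ∀ C D x i j, i ∉ C → j ∉ D → x i = x j → w (insert i C) (insert j D) x = w C D x

theorem crossFactor_union {C D : Finset ι} (hd : Disjoint C D) {x : ι → ℝ} {i j : ι}
    (hx : x i = x j) :
    crossFactor i (C ∪ D) x = 2 * x i * x j * ((∏ c ∈ C, (x i - x c) ^ 2)
      * (∏ d ∈ D, (x j - x d) ^ 2) * (∏ c ∈ C, (x i + x c)) * ∏ d ∈ D, (x j + x d)) := by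
  rw [crossFactor, prod_union hd, prod_mul_distrib, prod_mul_distrib, ← hx]
  ring

theorem IsSplitting.weight_mul [Fintype ι] {g w : Finset ι → Finset ι → (ι → ℝ) → ℝ}
    (hg : IsSplitting g) (hw : IsWeight w) : IsSplitting fun C D x => w C D x * g C D x where
  differentiable C D := (hw.differentiable C D).mul (hg.differentiable C D)
  map e C D x := by rw [hw.map, hg.map]
  left C D x i j hi hj hij hx := by rw [hg.left C D x i j hi hj hij hx, mul_zero]
  right C D x i j hi hj hij hx := by rw [hg.right C D x i j hi hj hij hx, mul_zero]
  cross C D x i j hd hi hj hij hx := by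
    rw [hg.cross C D x i j hd hi hj hij hx,
      hw.cross C D x i j (fun h => hi (mem_union_left _ h)) (fun h => hj (mem_union_right _ h)) hx]
    ring

theorem IsSplitting.sub [Fintype ι] {g g' : Finset ι → Finset ι → (ι → ℝ) → ℝ} (hg : IsSplitting g)
    (hg' : IsSplitting g') : IsSplitting fun C D x => g C D x - g' C D x where
  differentiable C D := (hg.differentiable C D).sub (hg'.differentiable C D)
  map e C D x := by rw [hg.map, hg'.map]
  left C D x i j hi hj hij hx := by
    rw [hg.left C D x i j hi hj hij hx, hg'.left C D x i j hi hj hij hx, sub_zero]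
  right C D x i j hi hj hij hx := by
    rw [hg.right C D x i j hi hj hij hx, hg'.right C D x i j hi hj hij hx, sub_zero]
  cross C D x i j hd hi hj hij hx := by
    rw [hg.cross C D x i j hd hi hj hij hx, hg'.cross C D x i j hd hi hj hij hx, mul_sub]

theorem isSplitting_splitKernel [Fintype ι] :
    IsSplitting (splitKernel : Finset ι → Finset ι → (ι → ℝ) → ℝ) where
  differentiable C D := by
    unfold splitKernel vandSq pairProd
    fun_prop
  map e C D x := by simp [splitKernel, vandSq_map]
  left C D x i j hi hj hij hx := by simp [splitKernel, vandSq_eq_zero hi hj hij hx]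
  right C D x i j hi hj hij hx := by simp [splitKernel, vandSq_eq_zero hi hj hij hx]
  cross C D x i j hd hi hj hij hx := by
    rw [crossFactor_union hd hx]
    simp only [mem_union, not_or] at hi hj
    simp only [splitKernel, vandSq_insert hi.1, vandSq_insert hj.2, prod_insert hi.1,
      prod_insert hj.2, prod_mul_distrib, add_comm _ (x j)]
    rw [← hx]
    ring

theorem isSplitting_posKernel [Fintype ι] :
    IsSplitting (posKernel : Finset ι → Finset ι → (ι → ℝ) → ℝ) where
  differentiable C D := by
    unfold posKernel vandSq plusProd pairProd
    split_ifs <;> fun_prop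
  map e C D x := by simp [posKernel, vandSq_map, plusProd_map]
  left C D x i j hi hj hij hx := by simp [posKernel, vandSq_eq_zero hi hj hij hx]
  right C D x i j hi hj hij hx := by simp [posKernel, vandSq_eq_zero hi hj hij hx]
  cross C D x i j hd hi hj hij hx := by
    rw [crossFactor_union hd hx]
    simp only [mem_union, not_or] at hi hj
    simp only [posKernel, vandSq_insert hi.1, vandSq_insert hj.2, plusProd_insert hi.1,
      plusProd_insert hj.2, prod_insert hi.1, prod_insert hj.2, card_insert_of_notMem hi.1,
      card_insert_of_notMem hj.2, add_left_inj]
    split_ifs <;> ring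

theorem polyLE_splitKernel_left {C D : Finset ι} {i : ι} (hi : i ∈ C) (hd : Disjoint C D)
    (x : ι → ℝ) :
    PolyLE (2 * C.card + D.card - 1) fun u => splitKernel C D (Function.update x i u) := by
  have hiD : i ∉ D := disjoint_left.1 hd hi
  have hcross : PolyLE D.card
      fun u => ∏ c ∈ C, ∏ d ∈ D, (Function.update x i u c + Function.update x i u d) := by
    obtain ⟨C, hC, rfl⟩ : ∃ C', i ∉ C' ∧ insert i C' = C :=
      ⟨C.erase i, notMem_erase i C, insert_erase hi⟩
    simp only [prod_insert hC, Function.update_self]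
    have h1 := polyLE_prod_update hiD x (f := fun u v => u + v) (d := 1)
      fun v => polyLE_id.add ((polyLE_const v).mono zero_le_one)
    refine (h1.mul (PolyLE.prod (d := 0) fun c hc => ?_)).mono (by simp)
    have hc : c ≠ i := fun h => hC (h ▸ hc)
    simpa [hc] using polyLE_prod_update hiD x (f := fun u v => x c + v) (d := 0)
      fun v => polyLE_const _
  have hpos := card_pos.2 ⟨i, hi⟩
  simp only [splitKernel, vandSq_update hiD]
  refine ((polyLE_prod_self hi x).mul
    (((polyLE_vandSq hi x).mul (polyLE_const (vandSq D x))).mul hcross)).mono ?_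
  omega

theorem polyLE_splitKernel_right {C D : Finset ι} {i : ι} (hi : i ∈ D) (hd : Disjoint C D)
    (x : ι → ℝ) :
    PolyLE (2 * D.card + C.card - 2) fun u => splitKernel C D (Function.update x i u) := by
  have hiC : i ∉ C := disjoint_right.1 hd hi
  have hcross : PolyLE C.card
      fun u => ∏ c ∈ C, ∏ d ∈ D, (Function.update x i u c + Function.update x i u d) := by
    refine (PolyLE.prod (d := 1) fun c hc => ?_).mono (by simp)
    have hc : c ≠ i := fun h => hiC (h ▸ hc)
    obtain ⟨D, hD, rfl⟩ : ∃ D', i ∉ D' ∧ insert i D' = D :=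
      ⟨D.erase i, notMem_erase i D, insert_erase hi⟩
    simp only [prod_insert hD, Function.update_self, Function.update_of_ne hc]
    refine ((((polyLE_const (x c)).mono zero_le_one).add polyLE_id).mul
      (polyLE_prod_update hD x (f := fun u v => x c + v) (d := 0) fun v => polyLE_const _)).mono
      (by simp)
  have hpos := card_pos.2 ⟨i, hi⟩
  simp only [splitKernel, vandSq_update hiC]
  refine ((polyLE_prod_of_notMem hiC x).mul
    (((polyLE_const (vandSq C x)).mul (polyLE_vandSq hi x)).mul hcross)).mono ?_
  omega

theorem posKernel_comm (C D : Finset ι) (x : ι → ℝ) : posKernel C D x = posKernel D C x := by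
  unfold posKernel
  by_cases h : C.card = D.card
  · rw [if_pos h, if_pos h.symm, h]; ring
  · rw [if_neg h, if_neg (Ne.symm h)]

theorem polyLE_posKernel {C D : Finset ι} {i : ι} (hi : i ∈ C ∪ D) (hd : Disjoint C D)
    (x : ι → ℝ) (h2 : 2 < C.card + D.card) :
    PolyLE (2 * (C.card + D.card) - 3) fun u => posKernel C D (Function.update x i u) := by
  wlog hiC : i ∈ C generalizing C D
  · have hiD : i ∈ D := (mem_union.1 hi).resolve_left hiC
    simp only [posKernel_comm C D]
    rw [add_comm] at h2 ⊢
    exact this (by simp [hiD]) hd.symm h2 hiD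
  have hiD : i ∉ D := disjoint_left.1 hd hiC
  unfold posKernel
  by_cases h : C.card = D.card
  · simp only [if_pos h, vandSq_update hiD, plusProd_update hiD]
    refine ((PolyLE.const_mul _ (((polyLE_prod_self hiC x).mul (polyLE_vandSq hiC x)).mul
      (polyLE_plusProd hiC x))).mul (((polyLE_prod_of_notMem hiD x).mul
      (polyLE_const (vandSq D x))).mul (polyLE_const (plusProd D x)))).mono ?_
    omega
  · simpa only [if_neg h] using (polyLE_const 0).mono (Nat.zero_le _)

end Kernels

/-! ### Identities between splitting sums -/

section Identities

variable {ι : Type*} [LinearOrder ι]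

/-- The signed coefficients with which the splittings `C, D` occur in
`σ_p' τ_{p+1} - σ_p τ_{p+1}' + σ_{p+1} τ_p - σ_{p-1} τ_{p+2}`. -/
def weightS (C D : Finset ι) (x : ι → ℝ) : ℝ :=
  if C.card + 1 = D.card then ∑ c ∈ C, x c - ∑ d ∈ D, x d
  else if C.card = D.card + 1 then 1
  else if C.card + 3 = D.card then -1 else 0

/-- The coefficients with which the splittings `C, D` occur in
`σ_p' τ_p - σ_p τ_p' + σ_{p-1}' τ_{p+1} - σ_{p-1} τ_{p+1}'`. -/
def weightR (C D : Finset ι) (x : ι → ℝ) : ℝ :=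
  if C.card = D.card ∨ C.card + 2 = D.card then ∑ c ∈ C, x c - ∑ d ∈ D, x d else 0

/-- The signs with which the splittings `C, D` occur in `σ_p τ_p - σ_{p-1} τ_{p+1}`. -/
def weightW (C D : Finset ι) (_ : ι → ℝ) : ℝ :=
  if C.card = D.card then 1 else if C.card + 2 = D.card then -1 else 0

theorem isWeight_weightS [Fintype ι] :
    IsWeight (weightS : Finset ι → Finset ι → (ι → ℝ) → ℝ) where
  differentiable C D := by unfold weightS; split_ifs <;> fun_prop
  map e C D x := by simp [weightS]
  cross C D x i j hi hj hx := by
    simp only [weightS, card_insert_of_notMem hi, card_insert_of_notMem hj, sum_insert hi,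
      sum_insert hj, hx, add_sub_add_left_eq_sub, add_left_inj, add_right_comm _ 1 3]

theorem isWeight_weightR [Fintype ι] :
    IsWeight (weightR : Finset ι → Finset ι → (ι → ℝ) → ℝ) where
  differentiable C D := by unfold weightR; split_ifs <;> fun_prop
  map e C D x := by simp [weightR]
  cross C D x i j hi hj hx := by
    simp only [weightR, card_insert_of_notMem hi, card_insert_of_notMem hj, sum_insert hi,
      sum_insert hj, hx, add_sub_add_left_eq_sub, add_left_inj, add_right_comm _ 1 2]

theorem isWeight_weightW [Fintype ι] :
    IsWeight (weightW : Finset ι → Finset ι → (ι → ℝ) → ℝ) where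
  differentiable C D := by unfold weightW; split_ifs <;> fun_prop
  map e C D x := by simp [weightW]
  cross C D x i j hi hj hx := by
    simp only [weightW, card_insert_of_notMem hi, card_insert_of_notMem hj, add_left_inj,
      add_right_comm _ 1 2]

theorem polyLE_sum_sub_sum (C D : Finset ι) (x : ι → ℝ) (i : ι) :
    PolyLE 1 fun u => ∑ c ∈ C, Function.update x i u c - ∑ d ∈ D, Function.update x i u d :=
  (PolyLE.sum fun c _ => polyLE_update x i c).sub (PolyLE.sum fun d _ => polyLE_update x i d)

/-- The degree of `splitKernel C D` depends on whether the variable has its index in `C` or in `D`;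
a weight of degree `m` adds to it. -/
theorem polyLE_mul_splitKernel {C D : Finset ι} (hd : Disjoint C D) {x : ι → ℝ} {i : ι}
    (hi : i ∈ C ∪ D) {f : ℝ → ℝ} {m d : ℕ} (hf : PolyLE m f)
    (hC : m + (2 * C.card + D.card - 1) ≤ d) (hD : m + (2 * D.card + C.card - 2) ≤ d) :
    PolyLE d fun u => f u * splitKernel C D (Function.update x i u) := by
  rcases mem_union.1 hi with h | h
  · exact (hf.mul (polyLE_splitKernel_left h hd x)).mono hC
  · exact (hf.mul (polyLE_splitKernel_right h hd x)).mono hD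

theorem splitSum_empty (g : Finset ι → Finset ι → (ι → ℝ) → ℝ) (x : ι → ℝ) :
    splitSum g ∅ x = g ∅ ∅ x := by simp [splitSum]

/-- Adding an index to `B` doubles the number of splittings; the repeated use of this writes the
sum over a small set out in full. -/
theorem splitSum_insert (g : Finset ι → Finset ι → (ι → ℝ) → ℝ) {i : ι} {B : Finset ι}
    (hi : i ∉ B) (x : ι → ℝ) :
    splitSum g (insert i B) x = splitSum (fun C D x => g C (insert i D) x) B x
      + splitSum (fun C D x => g (insert i C) D x) B x := by
  simp only [splitSum]
  rw [← sum_add_distrib]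
  exact sum_powerset_insert_split hi fun C D => g C D x

/-- In each variable the summands have degree at most `N + (N - 1) / 2`, where `N` is the
cardinality of `B`, so that only `N ≤ 3` has to be computed. -/
theorem splitSum_weightS [Fintype ι] {B : Finset ι} {x : ι → ℝ} (hx : Set.InjOn x B) :
    splitSum (fun C D x => weightS C D x * splitKernel C D x) B x = 0 := by
  refine (isSplitting_splitKernel.weight_mul isWeight_weightS).splitSum_eq_zero 3 (by norm_num)
    (fun C D y i hd hi h3 => ?_) (fun B hB y => ?_) B x hx
  · unfold weightS
    split_ifs with h1 h2 h2
    · exact polyLE_mul_splitKernel hd hi (polyLE_sum_sub_sum C D y i) (by omega) (by omega)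
    · exact polyLE_mul_splitKernel hd hi (polyLE_const 1) (by omega) (by omega)
    · exact polyLE_mul_splitKernel hd hi (polyLE_const (-1)) (by omega) (by omega)
    · simpa using (polyLE_const 0).mono (Nat.zero_le _)
  · have : B.card = 0 ∨ B.card = 1 ∨ B.card = 2 ∨ B.card = 3 := by omega
    rcases this with h | h | h | h
    · rw [card_eq_zero] at h
      subst h
      simp [splitSum_empty, weightS]
    · obtain ⟨a, rfl⟩ := card_eq_one.1 h
      rw [← insert_empty_eq, splitSum_insert _ (by simp)]
      simp [splitSum_empty, weightS, splitKernel]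
    · obtain ⟨a, b, hab, rfl⟩ := card_eq_two.1 h
      rw [← insert_empty_eq b, splitSum_insert _ (by simpa using hab),
        splitSum_insert _ (by simp), splitSum_insert _ (by simp)]
      simp [splitSum_empty, weightS, hab, card_insert_of_notMem]
    · obtain ⟨a, b, c, hab, hac, hbc, rfl⟩ := card_eq_three.1 h
      rw [← insert_empty_eq c]
      simp only [splitSum_insert, splitSum_empty, mem_insert, notMem_empty, hab, hac, hbc, or_self,
        not_false_eq_true]
      simp [weightS, splitKernel, vandSq_insert, card_insert_of_notMem, hab, hac, hbc,
        prod_insert, sum_insert]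
      ring

set_option maxRecDepth 4000 in
/-- In each variable the summands have degree at most `3 N / 2`, where `N` is the cardinality of
`B`, so that only `N ≤ 4` has to be computed. -/
theorem splitSum_weightR [Fintype ι] {B : Finset ι} {x : ι → ℝ} (hx : Set.InjOn x B) :
    splitSum (fun C D x => weightR C D x * splitKernel C D x) B x = 0 := by
  refine (isSplitting_splitKernel.weight_mul isWeight_weightR).splitSum_eq_zero 4 (by norm_num)
    (fun C D y i hd hi h3 => ?_) (fun B hB y => ?_) B x hx
  · unfold weightR
    split_ifs with h1
    · exact polyLE_mul_splitKernel hd hi (polyLE_sum_sub_sum C D y i) (by omega) (by omega)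
    · simpa using (polyLE_const 0).mono (Nat.zero_le _)
  · have : B.card = 0 ∨ B.card = 1 ∨ B.card = 2 ∨ B.card = 3 ∨ B.card = 4 := by omega
    rcases this with h | h | h | h | h
    · rw [card_eq_zero] at h
      subst h
      simp [splitSum_empty, weightR]
    · obtain ⟨a, rfl⟩ := card_eq_one.1 h
      rw [← insert_empty_eq, splitSum_insert _ (by simp)]
      simp [splitSum_empty, weightR]
    · obtain ⟨a, b, hab, rfl⟩ := card_eq_two.1 h
      rw [← insert_empty_eq b]
      simp only [splitSum_insert, splitSum_empty, mem_insert, notMem_empty, hab, or_self,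
        not_false_eq_true]
      simp [weightR, splitKernel, vandSq_insert, card_insert_of_notMem, hab, prod_insert,
        sum_insert]
      ring
    · obtain ⟨a, b, c, hab, hac, hbc, rfl⟩ := card_eq_three.1 h
      rw [← insert_empty_eq c]
      simp only [splitSum_insert, splitSum_empty, mem_insert, notMem_empty, hab, hac, hbc, or_self,
        not_false_eq_true]
      simp [weightR, card_insert_of_notMem, hab, hac, hbc]
    · obtain ⟨a, B, ha, rfl, h'⟩ := card_eq_succ.1 h
      obtain ⟨b, c, d, hbc, hbd, hcd, rfl⟩ := card_eq_three.1 h'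
      simp only [mem_insert, mem_singleton, not_or] at ha
      obtain ⟨hab, hac, had⟩ := ha
      rw [← insert_empty_eq d]
      simp only [splitSum_insert, splitSum_empty, mem_insert, notMem_empty, hab, hac, had, hbc,
        hbd, hcd, or_self, not_false_eq_true]
      simp [weightR, splitKernel, vandSq_insert, card_insert_of_notMem, hab, hac, had, hbc, hbd,
        hcd, prod_insert, sum_insert]
      ring

/-- The alternating sum equals a sum without cancellation. In each variable the summands on both
sides have degree at most `3 N / 2 - 1`, so that only `N ≤ 2` has to be computed. -/
theorem splitSum_weightW [Fintype ι] {B : Finset ι} {x : ι → ℝ} (hx : Set.InjOn x B) :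
    splitSum (fun C D x => weightW C D x * splitKernel C D x) B x = splitSum posKernel B x := by
  have key : splitSum (fun C D x => weightW C D x * splitKernel C D x - posKernel C D x) B x
      = 0 := by
    refine ((isSplitting_splitKernel.weight_mul isWeight_weightW).sub
      isSplitting_posKernel).splitSum_eq_zero 2 (by norm_num)
      (fun C D y i hd hi h3 => ?_) (fun B hB y => ?_) B x hx
    · refine PolyLE.sub ?_ (polyLE_posKernel hi hd y h3)
      unfold weightW
      split_ifs with h1 h2
      · exact polyLE_mul_splitKernel hd hi (polyLE_const 1) (by omega) (by omega)
      · exact polyLE_mul_splitKernel hd hi (polyLE_const (-1)) (by omega) (by omega)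
      · simpa using (polyLE_const 0).mono (Nat.zero_le _)
    · have : B.card = 0 ∨ B.card = 1 ∨ B.card = 2 := by omega
      rcases this with h | h | h
      · rw [card_eq_zero] at h
        subst h
        simp [splitSum_empty, weightW, splitKernel, posKernel]
      · obtain ⟨a, rfl⟩ := card_eq_one.1 h
        rw [← insert_empty_eq, splitSum_insert _ (by simp)]
        simp [splitSum_empty, weightW, posKernel]
      · obtain ⟨a, b, hab, rfl⟩ := card_eq_two.1 h
        rw [← insert_empty_eq b]
        simp only [splitSum_insert, splitSum_empty, mem_insert, notMem_empty, hab, or_self,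
          not_false_eq_true]
        simp [weightW, splitKernel, posKernel, vandSq_insert, card_insert_of_notMem, hab,
          prod_insert]
        ring
  simpa only [splitSum, sum_sub_distrib, sub_eq_zero] using key

end Identities

/-! ### Double sums over pairs of index sets -/

section Bilinear

/-- A pair `J, K` of finite sets corresponds to `A = J ∩ K` and the splitting `C = J \ K`,
`B \ C = K \ J` of the symmetric difference `B`, which is disjoint from `A`. -/
theorem sum_pairs_eq_sum_splittings {ι M : Type*} [DecidableEq ι] [Fintype ι] [AddCommMonoid M]
    (φ : Finset ι → Finset ι → M) :
    ∑ J, ∑ K, φ J K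
      = ∑ A : Finset ι, ∑ B ∈ Aᶜ.powerset, ∑ C ∈ B.powerset, φ (A ∪ C) (A ∪ (B \ C)) := by
  simp only [sum_sigma']
  refine sum_bij' (fun p _ => ⟨p.1 ∩ p.2, (p.1 \ p.2) ∪ (p.2 \ p.1), p.1 \ p.2⟩)
    (fun q _ => ⟨q.1 ∪ q.2.2, q.1 ∪ (q.2.1 \ q.2.2)⟩) ?_ ?_ ?_ ?_ ?_
  · rintro ⟨J, K⟩ -
    simp only [mem_sigma, mem_univ, true_and, mem_powerset]
    refine ⟨fun a => ?_, fun a => ?_⟩ <;> simp <;> tauto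
  · simp
  · rintro ⟨J, K⟩ -
    simp only [Sigma.mk.injEq, heq_eq_eq]
    constructor <;> ext a <;> simp <;> tauto
  · rintro ⟨A, B, C⟩ h
    simp only [mem_sigma, mem_univ, true_and, mem_powerset] at h
    have h1 : ∀ a, a ∈ B → a ∉ A := fun a ha => mem_compl.1 (h.1 ha)
    have h2 : ∀ a, a ∈ C → a ∈ B := fun a ha => h.2 ha
    have e1 : (A ∪ C) ∩ (A ∪ B \ C) = A := by
      ext a; have := h1 a; have := h2 a; simp; tauto
    have e2 : (A ∪ C) \ (A ∪ B \ C) = C := by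
      ext a; have := h1 a; have := h2 a; simp; tauto
    have e3 : (A ∪ B \ C) \ (A ∪ C) = B \ C := by
      ext a; have := h1 a; have := h2 a; simp; tauto
    simp only [e1, e2, e3, union_sdiff_of_subset h.2]
  · rintro ⟨J, K⟩ -
    have e1 : J ∩ K ∪ J \ K = J := by ext a; simp; tauto
    have e2 : J ∩ K ∪ (J \ K ∪ K \ J) \ (J \ K) = K := by ext a; simp; tauto
    simp only [e1, e2]

variable {ι : Type*} [LinearOrder ι]

/-- The summand `b_J Δ_J² / Γ_J` of the `τ_k`. -/
noncomputable def soliton (ζ b : ι → ℝ) (J : Finset ι) : ℝ :=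
  (∏ j ∈ J, b j) * vandSq J ζ / plusProd J ζ

theorem plusProd_pos {ζ : ι → ℝ} (hζ : ∀ j, 0 < ζ j) (J : Finset ι) : 0 < plusProd J ζ :=
  pairProd_pos fun i _ j _ _ => add_pos (hζ i) (hζ j)

theorem vandSq_pos {ζ : ι → ℝ} (hζ : Function.Injective ζ) (J : Finset ι) : 0 < vandSq J ζ :=
  pairProd_pos fun i _ j _ hij => by
    have := sub_ne_zero.2 (hζ.ne hij.ne)
    positivity

theorem soliton_pos {ζ b : ι → ℝ} (hζ : ∀ j, 0 < ζ j) (hinj : Function.Injective ζ)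
    (hb : ∀ j, 0 < b j) (J : Finset ι) : 0 < soliton ζ b J :=
  div_pos (mul_pos (prod_pos fun j _ => hb j) (vandSq_pos hinj J)) (plusProd_pos hζ J)

/-- The part of `ζ_J` times the `J`th and the `K`th summand of the `τ_k` that depends only on
`A = J ∩ K` and on the symmetric difference `B` of `J` and `K`. -/
noncomputable def pairCoeff (ζ b : ι → ℝ) (A B : Finset ι) : ℝ :=
  (∏ a ∈ A, ζ a) * soliton ζ b A ^ 2 * (∏ i ∈ B, b i)
    * (∏ i ∈ B, ∏ a ∈ A, (ζ a - ζ i) ^ 2 / (ζ a + ζ i)) / plusProd B ζ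

theorem pairCoeff_pos {ζ b : ι → ℝ} (hζ : ∀ j, 0 < ζ j) (hinj : Function.Injective ζ)
    (hb : ∀ j, 0 < b j) {A B : Finset ι} (hd : Disjoint A B) : 0 < pairCoeff ζ b A B := by
  refine div_pos (mul_pos (mul_pos (mul_pos (prod_pos fun j _ => hζ j)
    (pow_pos (soliton_pos hζ hinj hb A) 2)) (prod_pos fun j _ => hb j))
    (prod_pos fun i hi => prod_pos fun a ha => ?_)) (plusProd_pos hζ B)
  have := sub_ne_zero.2 (hinj.ne (fun h => disjoint_left.1 hd ha (h ▸ hi) : a ≠ i))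
  have := add_pos (hζ a) (hζ i)
  positivity

theorem soliton_union {ζ b : ι → ℝ} {A C : Finset ι} (hd : Disjoint A C) :
    soliton ζ b (A ∪ C) = soliton ζ b A * soliton ζ b C
      * ∏ i ∈ C, ∏ a ∈ A, (ζ a - ζ i) ^ 2 / (ζ a + ζ i) := by
  have h1 : vandSq (A ∪ C) ζ = vandSq A ζ * vandSq C ζ * ∏ c ∈ C, ∏ a ∈ A, (ζ a - ζ c) ^ 2 := by
    rw [prod_comm]; exact pairProd_union (fun _ _ => by ring) hd
  have h2 : plusProd (A ∪ C) ζ = plusProd A ζ * plusProd C ζ * ∏ c ∈ C, ∏ a ∈ A, (ζ a + ζ c) := by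
    rw [prod_comm]; exact pairProd_union (fun _ _ => by ring) hd
  rw [soliton, soliton, soliton, h1, h2, prod_union hd]
  simp only [prod_div_distrib]
  field_simp

theorem mul_soliton_mul_soliton {ζ b : ι → ℝ} (hζ : ∀ j, 0 < ζ j) {A C D : Finset ι}
    (hC : Disjoint A C) (hD : Disjoint A D) (hCD : Disjoint C D) :
    (∏ j ∈ A ∪ C, ζ j) * soliton ζ b (A ∪ C) * soliton ζ b (A ∪ D)
      = pairCoeff ζ b A (C ∪ D) * splitKernel C D ζ := by
  have h2 : plusProd (C ∪ D) ζ = plusProd C ζ * plusProd D ζ * ∏ c ∈ C, ∏ d ∈ D, (ζ c + ζ d) :=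
    pairProd_union (fun _ _ => by ring) hCD
  have h3 : ∏ c ∈ C, ∏ d ∈ D, (ζ c + ζ d) ≠ 0 :=
    (prod_pos fun c _ => prod_pos fun d _ => add_pos (hζ c) (hζ d)).ne'
  have h4 := (plusProd_pos hζ C).ne'
  have h5 := (plusProd_pos hζ D).ne'
  rw [soliton_union hC, soliton_union hD, pairCoeff, splitKernel, h2, prod_union hC,
    prod_union hCD, prod_union hCD]
  generalize ∏ i ∈ C, ∏ a ∈ A, (ζ a - ζ i) ^ 2 / (ζ a + ζ i) = QC
  generalize ∏ i ∈ D, ∏ a ∈ A, (ζ a - ζ i) ^ 2 / (ζ a + ζ i) = QD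
  rw [soliton.eq_1 ζ b C, soliton.eq_1 ζ b D]
  field_simp

/-- A quadratic expression in the summands of the `τ_k`, whose coefficients depend only on the
differences of the two index sets, is a combination of splitting sums. -/
theorem sum_pairs_weight [Fintype ι] {ζ b : ι → ℝ} (hζ : ∀ j, 0 < ζ j)
    (w : Finset ι → Finset ι → (ι → ℝ) → ℝ) (T : ℤ) :
    (∑ J, ∑ K, if (J.card : ℤ) + K.card = T then
        w (J \ K) (K \ J) ζ * ((∏ j ∈ J, ζ j) * soliton ζ b J * soliton ζ b K) else 0)
      = ∑ A : Finset ι, ∑ B ∈ Aᶜ.powerset, if 2 * (A.card : ℤ) + B.card = T then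
        pairCoeff ζ b A B * splitSum (fun C D x => w C D x * splitKernel C D x) B ζ else 0 := by
  rw [sum_pairs_eq_sum_splittings]
  refine sum_congr rfl fun A _ => sum_congr rfl fun B hB => ?_
  have hAB : Disjoint A B := disjoint_left.2 fun a ha hb =>
    mem_compl.1 (mem_powerset.1 hB hb) ha
  have key : ∀ C ∈ B.powerset, (if ((A ∪ C).card : ℤ) + (A ∪ (B \ C)).card = T then
        w ((A ∪ C) \ (A ∪ (B \ C))) ((A ∪ (B \ C)) \ (A ∪ C)) ζ
          * ((∏ j ∈ A ∪ C, ζ j) * soliton ζ b (A ∪ C) * soliton ζ b (A ∪ (B \ C))) else 0)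
      = if 2 * (A.card : ℤ) + B.card = T then
        pairCoeff ζ b A B * (w C (B \ C) ζ * splitKernel C (B \ C) ζ) else 0 := by
    intro C hC
    have hCB := mem_powerset.1 hC
    have hAC : Disjoint A C := disjoint_of_subset_right hCB hAB
    have hAD : Disjoint A (B \ C) := disjoint_of_subset_right sdiff_subset hAB
    have hCD : Disjoint C (B \ C) := disjoint_sdiff
    have e1 : (A ∪ C) \ (A ∪ B \ C) = C := by
      rw [union_sdiff_distrib, sdiff_eq_empty_iff_subset.2 subset_union_left, empty_union,
        sdiff_eq_self_of_disjoint (disjoint_union_right.2 ⟨hAC.symm, hCD⟩)]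
    have e2 : (A ∪ B \ C) \ (A ∪ C) = B \ C := by
      rw [union_sdiff_distrib, sdiff_eq_empty_iff_subset.2 subset_union_left, empty_union,
        sdiff_eq_self_of_disjoint (disjoint_union_right.2 ⟨hAD.symm, hCD.symm⟩)]
    have hcard : ((A ∪ C).card : ℤ) + (A ∪ (B \ C)).card = 2 * (A.card : ℤ) + B.card := by
      rw [card_union_of_disjoint hAC, card_union_of_disjoint hAD,
        ← card_sdiff_add_card_eq_card hCB]
      push_cast
      ring
    rw [hcard, e1, e2, mul_soliton_mul_soliton hζ hAC hAD hCD, union_sdiff_of_subset hCB]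
    split_ifs <;> ring
  rw [sum_congr rfl key, splitSum, mul_sum]
  split_ifs <;> simp

end Bilinear

/-! ### The functions `τ_k` and `σ_k` -/

section Tau

variable {n : ℕ}

theorem Delta_sq (ζ : Fin n → ℝ) (J : Finset (Fin n)) : Delta ζ J ^ 2 = vandSq J ζ := by
  rw [Delta, vandSq, pairProd, ← prod_pow]
  exact prod_congr rfl fun _ _ => by ring

theorem Gamma_eq (ζ : Fin n → ℝ) (J : Finset (Fin n)) : Gamma ζ J = plusProd J ζ :=
  prod_congr rfl fun _ _ => by ring

theorem tau_eq (ζ b : Fin n → ℝ) (k : ℤ) :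
    tau ζ b k = ∑ J : Finset (Fin n), if (J.card : ℤ) = k then soliton ζ b J else 0 := by
  rw [tau, sum_filter]
  simp only [Delta_sq, Gamma_eq, soliton]

theorem sigma_eq (ζ b : Fin n → ℝ) (k : ℤ) :
    sigma ζ b k = ∑ J : Finset (Fin n),
      if (J.card : ℤ) = k then (∏ j ∈ J, ζ j) * soliton ζ b J else 0 := by
  rw [sigma, sum_filter]
  simp only [Delta_sq, Gamma_eq, soliton, mul_assoc, mul_div_assoc]

/-- The time derivative of `τ_k`. -/
noncomputable def tauDot (ζ b : Fin n → ℝ) (k : ℤ) : ℝ :=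
  ∑ J : Finset (Fin n), if (J.card : ℤ) = k then (∑ j ∈ J, ζ j) * soliton ζ b J else 0

/-- The time derivative of `σ_k`. -/
noncomputable def sigmaDot (ζ b : Fin n → ℝ) (k : ℤ) : ℝ :=
  ∑ J : Finset (Fin n),
    if (J.card : ℤ) = k then (∑ j ∈ J, ζ j) * ((∏ j ∈ J, ζ j) * soliton ζ b J) else 0

theorem hasDerivAt_prod {ι : Type*} {ζ : ι → ℝ} {b : ι → ℝ → ℝ} {t : ℝ}
    (hb : ∀ j, HasDerivAt (b j) (ζ j * b j t) t) (J : Finset ι) :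
    HasDerivAt (fun t => ∏ j ∈ J, b j t) ((∑ j ∈ J, ζ j) * ∏ j ∈ J, b j t) t := by
  classical
  induction J using Finset.induction_on with
  | empty => simpa using hasDerivAt_const t (1 : ℝ)
  | insert i J hi ih =>
    simp only [prod_insert hi, sum_insert hi]
    exact ((hb i).fun_mul ih).congr_deriv (by ring)

theorem hasDerivAt_soliton {ζ : Fin n → ℝ} {b : Fin n → ℝ → ℝ} {t : ℝ}
    (hb : ∀ j, HasDerivAt (b j) (ζ j * b j t) t) (J : Finset (Fin n)) :
    HasDerivAt (fun t => soliton ζ (fun j => b j t) J)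
      ((∑ j ∈ J, ζ j) * soliton ζ (fun j => b j t) J) t := by
  simp only [soliton]
  exact (((hasDerivAt_prod hb J).mul_const (vandSq J ζ)).div_const (plusProd J ζ)).congr_deriv
    (by ring)

theorem hasDerivAt_tau {ζ : Fin n → ℝ} {b : Fin n → ℝ → ℝ} {t : ℝ}
    (hb : ∀ j, HasDerivAt (b j) (ζ j * b j t) t) (k : ℤ) :
    HasDerivAt (fun t => tau ζ (fun j => b j t) k) (tauDot ζ (fun j => b j t) k) t := by
  simp only [tau_eq, tauDot]
  refine HasDerivAt.fun_sum fun J _ => ?_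
  split_ifs
  · exact hasDerivAt_soliton hb J
  · exact hasDerivAt_const _ _

theorem hasDerivAt_sigma {ζ : Fin n → ℝ} {b : Fin n → ℝ → ℝ} {t : ℝ}
    (hb : ∀ j, HasDerivAt (b j) (ζ j * b j t) t) (k : ℤ) :
    HasDerivAt (fun t => sigma ζ (fun j => b j t) k) (sigmaDot ζ (fun j => b j t) k) t := by
  simp only [sigma_eq, sigmaDot]
  refine HasDerivAt.fun_sum fun J _ => ?_
  split_ifs
  · exact ((hasDerivAt_soliton hb J).const_mul (∏ j ∈ J, ζ j)).congr_deriv (by ring)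
  · exact hasDerivAt_const _ _

variable {ζ b : Fin n → ℝ}

theorem tau_pos (hζ : ∀ j, 0 < ζ j) (hinj : Function.Injective ζ) (hb : ∀ j, 0 < b j) {k : ℤ}
    (h0 : 0 ≤ k) (hk : k ≤ n) : 0 < tau ζ b k := by
  lift k to ℕ using h0
  obtain ⟨J, -, hJ⟩ := exists_subset_card_eq (s := (univ : Finset (Fin n))) (n := k)
    (by simpa using hk)
  rw [tau_eq]
  refine sum_pos' (fun J _ => ?_) ⟨J, mem_univ J, ?_⟩
  · split_ifs
    · exact (soliton_pos hζ hinj hb J).le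
    · exact le_rfl
  · simpa [hJ] using soliton_pos hζ hinj hb J

theorem sigma_pos (hζ : ∀ j, 0 < ζ j) (hinj : Function.Injective ζ) (hb : ∀ j, 0 < b j) {k : ℤ}
    (h0 : 0 ≤ k) (hk : k ≤ n) : 0 < sigma ζ b k := by
  lift k to ℕ using h0
  obtain ⟨J, -, hJ⟩ := exists_subset_card_eq (s := (univ : Finset (Fin n))) (n := k)
    (by simpa using hk)
  have hpos : ∀ J : Finset (Fin n), 0 < (∏ j ∈ J, ζ j) * soliton ζ b J := fun J =>
    mul_pos (prod_pos fun j _ => hζ j) (soliton_pos hζ hinj hb J)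
  rw [sigma_eq]
  refine sum_pos' (fun J _ => ?_) ⟨J, mem_univ J, ?_⟩
  · split_ifs
    · exact (hpos J).le
    · exact le_rfl
  · simpa [hJ] using hpos J

theorem tau_eq_zero {k : ℤ} (hk : k < 0 ∨ n < k) : tau ζ b k = 0 := by
  rw [tau_eq]
  refine sum_eq_zero fun J _ => if_neg ?_
  have := card_le_univ J
  rw [Fintype.card_fin] at this
  omega

theorem sigma_eq_zero {k : ℤ} (hk : k < 0 ∨ n < k) : sigma ζ b k = 0 := by
  rw [sigma_eq]
  refine sum_eq_zero fun J _ => if_neg ?_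
  have := card_le_univ J
  rw [Fintype.card_fin] at this
  omega

theorem card_eq_sdiff_add_inter {ι : Type*} [DecidableEq ι] (J K : Finset ι) :
    J.card = (J \ K).card + (J ∩ K).card ∧ K.card = (K \ J).card + (J ∩ K).card :=
  ⟨(card_sdiff_add_card_inter J K).symm, by
    rw [inter_comm]; exact (card_sdiff_add_card_inter K J).symm⟩

/-- The bilinear identity behind the equation for `s_k'`. -/
theorem bilinear_s (hζ : ∀ j, 0 < ζ j) (hinj : Function.Injective ζ) (p : ℤ) :
    sigmaDot ζ b p * tau ζ b (p + 1) - sigma ζ b p * tauDot ζ b (p + 1)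
      + sigma ζ b (p + 1) * tau ζ b p - sigma ζ b (p - 1) * tau ζ b (p + 2) = 0 := by
  have h := sum_pairs_weight (b := b) hζ weightS (2 * p + 1)
  simp only [splitSum_weightS hinj.injOn, mul_zero, ite_self, sum_const_zero] at h
  rw [← h]
  simp only [tau_eq, sigma_eq, tauDot, sigmaDot, sum_mul_sum, ← sum_add_distrib,
    ← sum_sub_distrib, ite_zero_mul_ite_zero]
  refine sum_congr rfl fun J _ => sum_congr rfl fun K _ => ?_
  obtain ⟨hJ, hK⟩ := card_eq_sdiff_add_inter J K
  simp only [weightS, sum_sdiff_sub_sum_sdiff]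
  split_ifs <;> first | (exfalso; omega) | ring

/-- The bilinear identity behind the equation for `r_k'`. -/
theorem bilinear_r (hζ : ∀ j, 0 < ζ j) (hinj : Function.Injective ζ) (p : ℤ) :
    sigmaDot ζ b p * tau ζ b p - sigma ζ b p * tauDot ζ b p
      + sigmaDot ζ b (p - 1) * tau ζ b (p + 1) - sigma ζ b (p - 1) * tauDot ζ b (p + 1) = 0 := by
  have h := sum_pairs_weight (b := b) hζ weightR (2 * p)
  simp only [splitSum_weightR hinj.injOn, mul_zero, ite_self, sum_const_zero] at h
  rw [← h]
  simp only [tau_eq, sigma_eq, tauDot, sigmaDot, sum_mul_sum, ← sum_add_distrib,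
    ← sum_sub_distrib, ite_zero_mul_ite_zero]
  refine sum_congr rfl fun J _ => sum_congr rfl fun K _ => ?_
  obtain ⟨hJ, hK⟩ := card_eq_sdiff_add_inter J K
  simp only [weightR, sum_sdiff_sub_sum_sdiff]
  split_ifs <;> first | (exfalso; omega) | ring

theorem splitSum_posKernel_nonneg (hζ : ∀ j, 0 < ζ j) (hinj : Function.Injective ζ)
    (B : Finset (Fin n)) : 0 ≤ splitSum posKernel B ζ := by
  have hpos : ∀ C : Finset (Fin n), 0 < (∏ c ∈ C, ζ c) * vandSq C ζ * plusProd C ζ := fun C =>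
    mul_pos (mul_pos (prod_pos fun j _ => hζ j) (vandSq_pos hinj C)) (plusProd_pos hζ C)
  refine sum_nonneg fun C _ => ?_
  unfold posKernel
  split_ifs
  · have h1 := hpos C
    have h2 := hpos (B \ C)
    positivity
  · exact le_rfl

/-- The differences `s_{p+1} - s_p` have a constant sign, because their numerators are sums of
positive terms. -/
theorem sigma_mul_tau_sub_pos (hζ : ∀ j, 0 < ζ j) (hinj : Function.Injective ζ)
    (hb : ∀ j, 0 < b j) {p : ℤ} (h0 : 0 ≤ p) (hp : p ≤ n) :
    0 < sigma ζ b p * tau ζ b p - sigma ζ b (p - 1) * tau ζ b (p + 1) := by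
  have h := sum_pairs_weight (b := b) hζ weightW (2 * p)
  simp only [splitSum_weightW hinj.injOn] at h
  have hW : sigma ζ b p * tau ζ b p - sigma ζ b (p - 1) * tau ζ b (p + 1)
      = ∑ A : Finset (Fin n), ∑ B ∈ Aᶜ.powerset, if 2 * (A.card : ℤ) + B.card = 2 * p then
        pairCoeff ζ b A B * splitSum posKernel B ζ else 0 := by
    rw [← h]
    simp only [tau_eq, sigma_eq, sum_mul_sum, ← sum_sub_distrib, ite_zero_mul_ite_zero]
    refine sum_congr rfl fun J _ => sum_congr rfl fun K _ => ?_
    obtain ⟨hJ, hK⟩ := card_eq_sdiff_add_inter J K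
    simp only [weightW]
    split_ifs <;> first | (exfalso; omega) | ring
  have hnonneg : ∀ A : Finset (Fin n), ∀ B ∈ Aᶜ.powerset,
      0 ≤ if 2 * (A.card : ℤ) + B.card = 2 * p then
        pairCoeff ζ b A B * splitSum posKernel B ζ else 0 := by
    intro A B hB
    split_ifs
    · exact mul_nonneg (pairCoeff_pos hζ hinj hb (disjoint_left.2 fun a ha hb =>
        mem_compl.1 (mem_powerset.1 hB hb) ha)).le (splitSum_posKernel_nonneg hζ hinj B)
    · exact le_rfl
  rw [hW]
  lift p to ℕ using h0
  -- The diagonal pairs `J = K` contribute positive terms.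
  obtain ⟨A, -, hA⟩ := exists_subset_card_eq (s := (univ : Finset (Fin n))) (n := p)
    (by simpa using hp)
  refine sum_pos' (fun A _ => sum_nonneg fun B hB => hnonneg A B hB) ⟨A, mem_univ A,
    sum_pos' (hnonneg A) ⟨∅, empty_mem_powerset _, ?_⟩⟩
  simpa [hA, splitSum_empty, posKernel] using pairCoeff_pos hζ hinj hb (disjoint_empty_right A)


theorem pos_of_hasDerivAt_mul {c : ℝ} {b : ℝ → ℝ} (hb : ∀ t, HasDerivAt b (c * b t) t)
    (h0 : 0 < b 0) (t : ℝ) : 0 < b t := by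
  have hd : ∀ t, HasDerivAt (fun t => b t * Real.exp (-(c * t))) 0 t := by
    intro t
    have h1 : HasDerivAt (fun t => Real.exp (-(c * t))) (Real.exp (-(c * t)) * -(c * 1)) t :=
      (((hasDerivAt_id t).const_mul c).neg).exp
    exact ((hb t).fun_mul h1).congr_deriv (by ring)
  have hc := is_const_of_deriv_eq_zero (fun t => (hd t).differentiableAt)
    (fun t => (hd t).deriv) t 0
  simp only [mul_zero, neg_zero, Real.exp_zero, mul_one] at hc
  rw [← hc] at h0
  exact pos_of_mul_pos_left h0 (Real.exp_pos _).le

/-- With `r = t₁ / t₀` and with `q₀ / t₀`, `q₁ / t₁` for two consecutive `s`, the equation for `r'`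
reduces to a bilinear identity; `dt₀, …, dq₁` are the derivatives. -/
theorem r_equation_of_bilinear {t₀ t₁ q₀ q₁ dt₀ dt₁ dq₀ dq₁ : ℝ} (h₀ : t₀ ≠ 0) (h₁ : t₁ ≠ 0)
    (hW : q₀ / t₀ - q₁ / t₁ ≠ 0) (h : dq₁ * t₀ - q₁ * dt₀ + dq₀ * t₁ - q₀ * dt₁ = 0) :
    (dt₁ * t₀ - t₁ * dt₀) / t₀ ^ 2
      = t₁ / t₀ * ((dq₀ * t₀ - q₀ * dt₀) / t₀ ^ 2 + (dq₁ * t₁ - q₁ * dt₁) / t₁ ^ 2)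
        / (q₀ / t₀ - q₁ / t₁) := by
  rw [eq_div_iff hW]
  field_simp
  linear_combination -(t₀ * t₁) * h

end Tau

end ModifiedBToda

theorem mainTheorem5 (n : ℕ) (ζ : Fin n → ℝ) (b : Fin n → ℝ → ℝ)
    (hζ_pos : ∀ j, 0 < ζ j) (hζ_mono : StrictMono ζ)
    (hb_ode : ∀ j t, HasDerivAt (b j) (ζ j * b j t) t)
    (hb_pos : ∀ j, 0 < b j 0) :
    (∀ k : ℤ, 0 ≤ k → k ≤ n → ∀ t : ℝ, ModifiedBToda.tau ζ (fun j => b j t) k ≠ 0) ∧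
    ModifiedBToda.IsSolution n
      (fun k t => ModifiedBToda.tau ζ (fun j => b j t) k /
        ModifiedBToda.tau ζ (fun j => b j t) (k - 1))
      (fun k t => ModifiedBToda.sigma ζ (fun j => b j t) (k - 1) /
        ModifiedBToda.tau ζ (fun j => b j t) k)
      (fun t => ModifiedBToda.sigma ζ (fun j => b j t) n /
        ModifiedBToda.tau ζ (fun j => b j t) n) := by
  open ModifiedBToda in
  have hinj := hζ_mono.injective
  have hb : ∀ t j, 0 < b j t := fun t j => pos_of_hasDerivAt_mul (hb_ode j) (hb_pos j) t
  have hτ : ∀ k : ℤ, 0 ≤ k → k ≤ n → ∀ t : ℝ, tau ζ (fun j => b j t) k ≠ 0 :=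
    fun k h0 hk t => (tau_pos hζ_pos hinj (hb t) h0 hk).ne'
  have hr : ∀ k : ℤ, 1 ≤ k → k ≤ n → ∀ t, HasDerivAt
      (fun t => tau ζ (fun j => b j t) k / tau ζ (fun j => b j t) (k - 1))
      ((tauDot ζ (fun j => b j t) k * tau ζ (fun j => b j t) (k - 1)
        - tau ζ (fun j => b j t) k * tauDot ζ (fun j => b j t) (k - 1))
        / tau ζ (fun j => b j t) (k - 1) ^ 2) t := fun k h1 hk t =>
    (hasDerivAt_tau (fun j => hb_ode j t) k).fun_div
      (hasDerivAt_tau (fun j => hb_ode j t) (k - 1)) (hτ _ (by omega) (by omega) t)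
  have hs : ∀ k : ℤ, 0 ≤ k → k ≤ n → ∀ t, HasDerivAt
      (fun t => sigma ζ (fun j => b j t) (k - 1) / tau ζ (fun j => b j t) k)
      ((sigmaDot ζ (fun j => b j t) (k - 1) * tau ζ (fun j => b j t) k
        - sigma ζ (fun j => b j t) (k - 1) * tauDot ζ (fun j => b j t) k)
        / tau ζ (fun j => b j t) k ^ 2) t := fun k h1 hk t =>
    (hasDerivAt_sigma (fun j => hb_ode j t) (k - 1)).fun_div
      (hasDerivAt_tau (fun j => hb_ode j t) k) (hτ _ h1 hk t)
  have hW : ∀ k : ℤ, 1 ≤ k → k ≤ n → ∀ t,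
      sigma ζ (fun j => b j t) (k - 1 - 1) / tau ζ (fun j => b j t) (k - 1)
        - sigma ζ (fun j => b j t) (k - 1) / tau ζ (fun j => b j t) k ≠ 0 := by
    intro k h1 hk t
    have h0 := hτ (k - 1) (by omega) (by omega) t
    have h2 := hτ k (by omega) hk t
    have hpos := sigma_mul_tau_sub_pos hζ_pos hinj (hb t) (p := k - 1) (by omega) (by omega)
    rw [sub_add_cancel] at hpos
    rw [div_sub_div _ _ h0 h2]
    exact div_ne_zero (by linarith : _ < (0 : ℝ)).ne (mul_ne_zero h0 h2)
  refine ⟨hτ, ?_⟩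
  constructor
  · intro t
    simp [sigma_eq_zero]
  · intro t
    simp [tau_eq_zero]
  · intro t
    exact (div_pos (sigma_pos hζ_pos hinj (hb t) (by omega) le_rfl)
      (tau_pos hζ_pos hinj (hb t) (by omega) le_rfl)).ne'
  · intro k h1 hk t
    exact div_ne_zero (hτ k (by omega) hk t) (hτ (k - 1) (by omega) (by omega) t)
  · exact hW
  · exact fun k h1 hk t => (hr k h1 hk t).differentiableAt
  · exact fun k h1 hk t => (hs k (by omega) hk t).differentiableAt
  · intro k h1 hk t
    have hbil := bilinear_r (b := fun j => b j t) hζ_pos hinj (k - 1)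
    rw [sub_add_cancel] at hbil
    rw [(hr k h1 hk t).deriv, (hs k (by omega) hk t).deriv,
      (hs (k - 1) (by omega) (by omega) t).deriv]
    exact r_equation_of_bilinear (hτ (k - 1) (by omega) (by omega) t) (hτ k (by omega) hk t)
      (hW k h1 hk t) hbil
  · intro k h1 hk t
    have hbil := bilinear_s (b := fun j => b j t) hζ_pos hinj (k - 1)
    rw [sub_add_cancel, show k - 1 + 2 = k + 1 by ring] at hbil
    have h0 := hτ (k - 1) (by omega) (by omega) t
    have h2 := hτ k (by omega) (by omega) t
    have h3 := hτ (k + 1) (by omega) (by omega) t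
    rw [(hs k (by omega) (by omega) t).deriv]
    rw [add_sub_cancel_right]
    field_simp
    linear_combination hbil
  · intro h1 t
    have hbil := bilinear_s (b := fun j => b j t) hζ_pos hinj ((n : ℤ) - 1)
    rw [sub_add_cancel, tau_eq_zero (k := (n : ℤ) - 1 + 2) (by omega)] at hbil
    have h0 := hτ ((n : ℤ) - 1) (by omega) (by omega) t
    have h2 := hτ n (by omega) le_rfl t
    -- The terms with `r_{n+1}` drop out because `τ_{n+1} = 0`.
    rw [(hs n (by omega) le_rfl t).deriv, tau_eq_zero (k := (n : ℤ) + 1) (by omega)]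
    field_simp
    linear_combination hbil
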